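/- Let $G$ be a locally compact (Hausdorff) abelian group with a fixed Haar measure $du$, let $(\Omega,\mathcal M,\mu)$ be an arbitrary measure space, and let $1\le p<\infty$. The scalar field is $\mathbb R$ or $\mathbb C$, the same for $L^1(G)$, $L^p(G)$ and $L^p(\mu)$. Let $u\mapsto R_u$ be a strongly continuous representation of $G$ on $L^p(\mu)$ by bounded linear operators such that $$c=\sup\{\|R_u\| : u\in G\}<\infty$$ and each $R_u$ is separation-preserving, that is, $R_uf$ and $R_ug$ have disjoint supports (up to $\mu$-null sets) whenever $f,g\in L^p(\mu)$ have disjoint supports (up to $\mu$-null sets). For a finite or infinite sequence $\{k_j\}\subset L^1(G)$ let $N_{p,\infty}(\{k_j\})$ denote the smallest constant $C\in[0,\infty]$ such that $$\Big\|\sup_j|k_j*f|\Big\|_{L^p(G)}\le C\,\|f\|_{L^p(G)}\qquad\text{for all } f\in L^p(G),$$ where $(k_j*f)(v)=\int_G k_j(u)f(v-u)\,du$. Suppose that $N_{p,\infty}(\{k_j\})<\infty$. Then for every $j$ and every $f\in L^p(\mu)$ the Bochner integral $$T_{k_j}f=\int_G k_j(u)R_{-u}f\,du$$ exists in $L^p(\mu)$,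 and the maximal operator $T^*f(x)=\sup_j|T_{k_j}f(x)|$ is bounded from $L^p(\mu)$ into itself with norm at most $c^2N_{p,\infty}(\{k_j\})$: for every $f\in L^p(\mu)$ we have $T^*f\in L^p(\mu)$ and $$\|T^*f\|_{L^p(\mu)}\le c^2\,N_{p,\infty}(\{k_j\})\,\|f\|_{L^p(\mu)}.$$ -/

import Mathlib

open MeasureTheory
open scoped ENNReal

noncomputable section

/-- `R` is a strongly continuous representation of the additive topological group `G` on the
normed space `X` by bounded linear operators. -/
structure IsStronglyContinuousRep {G 𝕜 X : Type*} [AddGroup G] [TopologicalSpace G]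
    [NontriviallyNormedField 𝕜] [NormedAddCommGroup X] [NormedSpace 𝕜 X]
    (R : G → X →L[𝕜] X) : Prop where
  map_zero : R 0 = ContinuousLinearMap.id 𝕜 X
  map_add : ∀ u v : G, R (u + v) = (R u).comp (R v)
  continuous_orbit : ∀ x : X, Continuous fun u : G => R u x

/-- The uniform bound `c = sup_u ‖R_u‖ ∈ [0, ∞]` of a family of bounded operators. -/
def supOpNorm {G 𝕜 X : Type*} [NontriviallyNormedField 𝕜] [NormedAddCommGroup X]
    [NormedSpace 𝕜 X] (R : G → X →L[𝕜] X) : ℝ≥0∞ :=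
  ⨆ u, ‖R u‖ₑ

/-- `S` maps functions with disjoint supports (up to null sets) to functions with disjoint
supports (up to null sets). -/
def IsSeparationPreserving {Ω 𝕜 : Type*} [MeasurableSpace Ω] {μ : Measure Ω} [RCLike 𝕜]
    {p : ℝ≥0∞} [Fact (1 ≤ p)] (S : Lp 𝕜 p μ →L[𝕜] Lp 𝕜 p μ) : Prop :=
  ∀ f g : Lp 𝕜 p μ, (∀ᵐ x ∂μ, f x = 0 ∨ g x = 0) → ∀ᵐ x ∂μ, S f x = 0 ∨ S g x = 0

/-- The maximal convolution function `v ↦ sup_j |(k_j * f)(v)|`, with values in `[0, ∞]`, where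
`(k_j * f)(v) = ∫ k_j(u) f(v - u) dm(u)`. -/
def maximalConvolution {G 𝕜 ι : Type*} [AddCommGroup G] [MeasurableSpace G] [RCLike 𝕜]
    (m : Measure G) (k : ι → G → 𝕜) (f : G → 𝕜) (v : G) : ℝ≥0∞ :=
  ⨆ j, ‖convolution (k j) f (ContinuousLinearMap.mul 𝕜 𝕜) m v‖ₑ

/-- `N_{p,∞}({k_j})`: the smallest `C ∈ [0, ∞]` such that
`‖sup_j |k_j * f|‖_{L^p(G)} ≤ C ‖f‖_{L^p(G)}` for all `f ∈ L^p(G)`. -/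
def maximalConvolutionNorm {G 𝕜 ι : Type*} [AddCommGroup G] [MeasurableSpace G] [RCLike 𝕜]
    (p : ℝ≥0∞) (m : Measure G) (k : ι → G → 𝕜) : ℝ≥0∞ :=
  sInf {C : ℝ≥0∞ | ∀ f : G → 𝕜, MemLp f p m →
    eLpNorm (maximalConvolution m k f) p m ≤ C * eLpNorm f p m}

/-- The transferred operator `T_k f = ∫ k(u) R_{-u} f dm(u)`, a Bochner integral in `L^p(μ)`. -/
def transferOp {G Ω 𝕜 : Type*} [AddCommGroup G] [MeasurableSpace G] [MeasurableSpace Ω]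
    {μ : Measure Ω} [RCLike 𝕜] {p : ℝ≥0∞} [Fact (1 ≤ p)] (m : Measure G)
    (R : G → Lp 𝕜 p μ →L[𝕜] Lp 𝕜 p μ) (k : G → 𝕜) (f : Lp 𝕜 p μ) : Lp 𝕜 p μ :=
  ∫ u, k u • R (-u) f ∂m

/-- The transferred maximal operator `T^* f(x) = sup_j |T_{k_j} f(x)|`, with values in
`[0, ∞]`. -/
def transferMaximal {G Ω 𝕜 ι : Type*} [AddCommGroup G] [MeasurableSpace G] [MeasurableSpace Ω]
    {μ : Measure Ω} [RCLike 𝕜] {p : ℝ≥0∞} [Fact (1 ≤ p)] (m : Measure G)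
    (R : G → Lp 𝕜 p μ →L[𝕜] Lp 𝕜 p μ) (k : ι → G → 𝕜) (f : Lp 𝕜 p μ) (x : Ω) : ℝ≥0∞ :=
  ⨆ j, ‖transferOp m R (k j) f x‖ₑ

end

/-!
The proof is by transference. For `f ∈ L^p(μ)` let `F v = R_v f` be its orbit function. Since
`T_k f = R_{-v} ((k * F)(v))` for every `v` (`transferOp_eq`), an estimate for the transferred
operators follows from an estimate for convolutions of `L^p(μ)`-valued functions on `G` at a single
point `v`. Three facts make this work.

* A separation-preserving operator `S` satisfies `sup_j |S g_j| = |S (sup_j |g_j|)|` for finite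
  families, hence passes to maximal functions without loss in norm
  (`IsSeparationPreserving.norm_tuple_le`). Applied to `S = R_{-v}` this gives one factor `c`; the
  other one comes from `‖F v‖ ≤ c ‖f‖`.
* The maximal inequality for the kernels `k_j` holds for functions on `G` with values in `L^p(μ)`.
  As neither `G` nor `Ω` is assumed σ-finite, joint measurability and Fubini's theorem are avoided:
  the orbit function is approximated, uniformly on a compact set, by a step function whose values
  are simple functions (`exists_step_approx`), and for these the exchange of integrals is an exchange
  of finite sums (`lintegral_convolution_simpleFunc_le`).
* A locally compact abelian group has polynomial growth, so for compact `K` there are compact sets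
  `V` and `W ⊇ V - K` with `m W ≤ (1 + δ) m V` (`exists_folner`). Cutting the orbit function off
  outside `W` does not change the convolution on `V` when the kernels live on `K`, and averaging
  over `V` costs a factor `1 + δ` only (`exists_norm_convolution_le`).

Letting the errors tend to zero yields the bound `c ^ 2 * N` for finitely many kernels
(`norm_tuple_transferOp_le`), and monotone convergence the one for countably many.
-/

/-! ### Følner sets in a locally compact abelian group -/

section Folner

open Pointwise

variable {G : Type*} [AddCommGroup G]

/-- The set `L + ⋯ + L` with `n + 1` summands. -/
def iteratedSum (L : Set G) : ℕ → Set G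
  | 0 => L
  | n + 1 => iteratedSum L n + L

open scoped Classical in
/-- If `L + L` is covered by the translates of `L` by the elements of a finite set `t`, then the
`(n + 1)`-fold sum of `L` is covered by the translates of `L` by the sums `∑ e_i • i` over `i ∈ t` with
`0 ≤ e_i ≤ n`. -/
theorem iteratedSum_subset (L : Set G) (t : Finset G) (ht : L + L ⊆ (t : Set G) + L) (n : ℕ) :
    iteratedSum L n ⊆ ⋃ e : t → Fin (n + 1), ({∑ i, (e i : ℕ) • (i : G)} : Set G) + L := by
  induction n with
  | zero =>
    intro x hx
    refine Set.mem_iUnion.2 ⟨fun _ => 0, ?_⟩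
    simpa [iteratedSum] using hx
  | succ n ih =>
    rintro x ⟨y, hy, l', hl', rfl⟩
    obtain ⟨e, he⟩ := Set.mem_iUnion.1 (ih hy)
    obtain ⟨z, hz, l, hl, rfl⟩ := he
    rw [Set.mem_singleton_iff] at hz
    obtain ⟨a, ha, l'', hl'', hal⟩ := ht (Set.add_mem_add hl hl')
    refine Set.mem_iUnion.2 ⟨fun i => ⟨(e i : ℕ) + if (i : G) = a then 1 else 0, by
      split_ifs <;> omega⟩, z + a, ?_, l'', hl'', ?_⟩
    · rw [Set.mem_singleton_iff, hz]
      simp only [add_smul, Finset.sum_add_distrib, add_right_inj]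
      rw [Finset.sum_eq_single (⟨a, ha⟩ : t)]
      · simp
      · rintro b - hb
        have : (b : G) ≠ a := fun h => hb (Subtype.ext h)
        simp [this]
      · simp
    · simp only at hal ⊢
      rw [add_assoc, hal, add_assoc]

variable [TopologicalSpace G] [IsTopologicalAddGroup G]

theorem isCompact_iteratedSum {L : Set G} (hL : IsCompact L) (n : ℕ) :
    IsCompact (iteratedSum L n) := by
  induction n with
  | zero => exact hL
  | succ n ih => exact ih.add hL

variable [MeasurableSpace G] [BorelSpace G] (m : Measure G) [m.IsAddHaarMeasure]

open scoped Classical in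
theorem measure_iteratedSum_le (L : Set G) (t : Finset G) (ht : L + L ⊆ (t : Set G) + L) (n : ℕ) :
    m (iteratedSum L n) ≤ (n + 1 : ℝ≥0∞) ^ t.card * m L := by
  refine (measure_mono (iteratedSum_subset L t ht n)).trans ((measure_iUnion_fintype_le m _).trans ?_)
  simp [Set.singleton_add, Set.image_add_left]

/-- Locally compact abelian groups satisfy the Følner condition: the sums `L + ⋯ + L` of a compact
neighbourhood `L` of `0` have polynomially growing measure, so the quotients of the measures of
consecutive ones cannot all exceed `1 + δ`. -/
theorem exists_folner [LocallyCompactSpace G] {K : Set G} (hK : IsCompact K) {δ : ℝ} (hδ : 0 < δ) :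
    ∃ V W : Set G, IsCompact V ∧ IsCompact W ∧ (∀ v ∈ V, ∀ u ∈ K, v - u ∈ W) ∧ m V ≠ 0 ∧
      m W ≤ ENNReal.ofReal (1 + δ) * m V := by
  obtain ⟨L₀, hL₀, h0⟩ := exists_compact_mem_nhds (0 : G)
  set L := L₀ ∪ -K
  have hL : IsCompact L := hL₀.union hK.neg
  have hLn : L ∈ nhds (0 : G) := Filter.mem_of_superset h0 Set.subset_union_left
  have hmL : m L ≠ 0 := (MeasureTheory.Measure.measure_pos_of_mem_nhds m hLn).ne'
  obtain ⟨t, -, ht⟩ := (hL.add hL).elim_nhds_subcover (fun x => x +ᵥ L) (fun x _ => by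
    simpa using vadd_mem_nhds_vadd x hLn)
  have ht' : L + L ⊆ (t : Set G) + L := by
    intro x hx
    obtain ⟨a, ha, hxa⟩ := Set.mem_iUnion₂.1 (ht hx)
    obtain ⟨l, hl, rfl⟩ := hxa
    exact Set.add_mem_add ha hl
  have hfin : ∀ n, m (iteratedSum L n) ≠ ∞ := fun n => (isCompact_iteratedSum hL n).measure_ne_top
  suffices h : ∃ n, m (iteratedSum L (n + 1)) ≤ ENNReal.ofReal (1 + δ) * m (iteratedSum L n) by
    obtain ⟨n, hn⟩ := h
    refine ⟨iteratedSum L n, iteratedSum L (n + 1), isCompact_iteratedSum hL n,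
      isCompact_iteratedSum hL (n + 1), ?_, ?_, hn⟩
    · intro v hv u hu
      rw [sub_eq_add_neg]
      exact Set.add_mem_add hv (Or.inr (by simpa using hu))
    · have : ∀ n, m L ≤ m (iteratedSum L n) := by
        intro n
        induction n with
        | zero => exact le_rfl
        | succ n ih =>
          refine ih.trans (measure_mono fun x hx => ?_)
          exact ⟨x, hx, 0, mem_of_mem_nhds hLn, add_zero x⟩
      exact fun h => hmL (le_antisymm (h ▸ this n) zero_le)
  by_contra! h
  have hgrow : ∀ n, (1 + δ) ^ n * (m L).toReal ≤ (m (iteratedSum L n)).toReal := by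
    intro n
    induction n with
    | zero => simp [iteratedSum]
    | succ n ih =>
      have h1 := ENNReal.toReal_mono (hfin _) (h n).le
      rw [ENNReal.toReal_mul, ENNReal.toReal_ofReal (by positivity)] at h1
      calc (1 + δ) ^ (n + 1) * (m L).toReal = (1 + δ) * ((1 + δ) ^ n * (m L).toReal) := by ring
        _ ≤ _ := (mul_le_mul_of_nonneg_left ih (by positivity)).trans h1
  have hpos : 0 < (m L).toReal := ENNReal.toReal_pos hmL hL.measure_ne_top
  have hpoly : ∀ n : ℕ, (1 + δ) ^ n ≤ ((n : ℝ) + 1) ^ t.card := by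
    intro n
    have h1 := ENNReal.toReal_mono (ENNReal.mul_ne_top (ENNReal.pow_ne_top (by simp))
      hL.measure_ne_top) (measure_iteratedSum_le m L t ht' n)
    rw [ENNReal.toReal_mul, ENNReal.toReal_pow] at h1
    have h2 : ((n : ℝ≥0∞) + 1).toReal = n + 1 := by
      rw [ENNReal.toReal_add (by simp) (by simp)]; simp
    rw [h2] at h1
    exact le_of_mul_le_mul_right ((hgrow n).trans h1) hpos
  have hlim := tendsto_pow_const_div_const_pow_of_one_lt t.card (show 1 < 1 + δ by linarith)
  have hev := (hlim.comp (Filter.tendsto_add_atTop_nat 1)).eventually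
    (gt_mem_nhds (show (0 : ℝ) < (1 + δ)⁻¹ by positivity))
  obtain ⟨n, hn⟩ := hev.exists
  simp only [Function.comp, Nat.cast_add, Nat.cast_one] at hn
  rw [div_lt_iff₀ (by positivity), pow_succ, mul_comm ((1 + δ) ^ n),
    inv_mul_cancel_left₀ (by positivity)] at hn
  exact absurd (hpoly n) (not_le.2 hn)

end Folner

/-! ### Separation-preserving operators and maximal functions -/

section SeparationPreserving

variable {Ω 𝕜 J : Type*} [MeasurableSpace Ω] {μ : Measure Ω} [RCLike 𝕜] {p : ℝ≥0∞}
  [Fact (1 ≤ p)]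

theorem lipschitzWith_ofReal_norm (E : Type*) [NormedAddCommGroup E] :
    LipschitzWith 1 fun y : E => ((‖y‖ : ℝ) : 𝕜) := by
  refine LipschitzWith.of_dist_le_mul fun x y => ?_
  rw [dist_eq_norm, ← RCLike.ofReal_sub, RCLike.norm_ofReal, NNReal.coe_one, one_mul, dist_eq_norm]
  exact abs_norm_sub_norm_le x y

variable (𝕜) in
/-- The function `x ↦ ‖g x‖`, as an element of the scalar-valued `L^p`. -/
noncomputable def Lp.pointwiseNorm {E : Type*} [NormedAddCommGroup E] (g : Lp E p μ) : Lp 𝕜 p μ :=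
  (lipschitzWith_ofReal_norm (𝕜 := 𝕜) E).compLp (by simp) g

omit [Fact (1 ≤ p)] in
theorem Lp.coeFn_pointwiseNorm {E : Type*} [NormedAddCommGroup E] (g : Lp E p μ) :
    ∀ᵐ x ∂μ, Lp.pointwiseNorm 𝕜 g x = ((‖g x‖ : ℝ) : 𝕜) :=
  LipschitzWith.coeFn_compLp _ _ g

theorem Lp.continuous_pointwiseNorm {E : Type*} [NormedAddCommGroup E] :
    Continuous (Lp.pointwiseNorm 𝕜 : Lp E p μ → Lp 𝕜 p μ) :=
  (lipschitzWith_ofReal_norm (𝕜 := 𝕜) E).continuous_compLp (by simp)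

omit [Fact (1 ≤ p)] in
theorem Lp.norm_pointwiseNorm {E : Type*} [NormedAddCommGroup E] (g : Lp E p μ) :
    ‖Lp.pointwiseNorm 𝕜 g‖ = ‖g‖ := by
  rw [Lp.norm_def, Lp.norm_def]
  congr 1
  refine eLpNorm_congr_norm_ae ?_
  filter_upwards [Lp.coeFn_pointwiseNorm (𝕜 := 𝕜) g] with x hx
  simp [hx]

variable [Fintype J]

/-- The `j`-th component of a function in the vector-valued `L^p`. -/
noncomputable def Lp.component (j : J) : Lp (J → 𝕜) p μ →L[𝕜] Lp 𝕜 p μ :=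
  (ContinuousLinearMap.proj (R := 𝕜) (φ := fun _ : J => 𝕜) j).compLpL p μ

theorem Lp.coeFn_component (j : J) (g : Lp (J → 𝕜) p μ) :
    ∀ᵐ x ∂μ, Lp.component j g x = g x j :=
  ContinuousLinearMap.coeFn_compLpL _ g

open scoped Classical in
/-- The `j`-th coordinate inclusion into the vector-valued `L^p`. -/
noncomputable def Lp.inclusion (j : J) : Lp 𝕜 p μ →L[𝕜] Lp (J → 𝕜) p μ :=
  (ContinuousLinearMap.single 𝕜 (fun _ : J => 𝕜) j).compLpL p μ

/-- The vector-valued function whose components are the given ones. As `J → 𝕜` carries the sup norm,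
its `L^p` norm is the norm of the maximal function `sup_j |g_j|`. -/
noncomputable def Lp.tuple (g : J → Lp 𝕜 p μ) : Lp (J → 𝕜) p μ := ∑ j, Lp.inclusion j (g j)

theorem Lp.coeFn_tuple (g : J → Lp 𝕜 p μ) :
    ∀ᵐ x ∂μ, Lp.tuple g x = fun j => g j x := by
  classical
  have h1 : ∀ᵐ x ∂μ, ∀ j, Lp.inclusion j (g j) x = Pi.single j (g j x) :=
    ae_all_iff.2 fun j => ContinuousLinearMap.coeFn_compLpL _ (g j)
  have h2 := Lp.coeFn_finsetSum Finset.univ (fun j => Lp.inclusion j (g j))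
  filter_upwards [h1, h2] with x hx1 hx2
  rw [Lp.tuple, hx2]
  ext i
  simp [hx1]

theorem Lp.norm_tuple_le (g : J → Lp 𝕜 p μ) : ‖Lp.tuple g‖ ≤ ∑ j, ‖g j‖ := by
  classical
  refine norm_sum_le_of_le _ fun j _ => Lp.norm_le_norm_of_ae_le ?_
  have h : ∀ᵐ x ∂μ, Lp.inclusion j (g j) x = Pi.single j (g j x) :=
    ContinuousLinearMap.coeFn_compLpL _ (g j)
  filter_upwards [h] with x hx
  rw [hx, Pi.norm_single]

theorem Lp.tuple_sub (g h : J → Lp 𝕜 p μ) : Lp.tuple (g - h) = Lp.tuple g - Lp.tuple h := by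
  simp [Lp.tuple, Finset.sum_sub_distrib]

/-- The operator induced by `S` on vector-valued functions, acting on each component. -/
noncomputable def Lp.mapComponents (J : Type*) [Fintype J] (S : Lp 𝕜 p μ →L[𝕜] Lp 𝕜 p μ) :
    Lp (J → 𝕜) p μ →L[𝕜] Lp (J → 𝕜) p μ :=
  ∑ j, (Lp.inclusion j).comp (S.comp (Lp.component j))

theorem Lp.mapComponents_apply (S : Lp 𝕜 p μ →L[𝕜] Lp 𝕜 p μ) (g : Lp (J → 𝕜) p μ) :
    Lp.mapComponents J S g = Lp.tuple fun j => S (Lp.component j g) := by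
  simp [Lp.mapComponents, Lp.tuple]

theorem Lp.coeFn_mapComponents (S : Lp 𝕜 p μ →L[𝕜] Lp 𝕜 p μ) (g : Lp (J → 𝕜) p μ) :
    ∀ᵐ x ∂μ, Lp.mapComponents J S g x = fun j => S (Lp.component j g) x := by
  rw [Lp.mapComponents_apply]
  exact Lp.coeFn_tuple _

theorem Lp.component_tuple (g : J → Lp 𝕜 p μ) (j : J) : Lp.component j (Lp.tuple g) = g j := by
  refine Lp.ext ?_
  filter_upwards [Lp.coeFn_component j (Lp.tuple g), Lp.coeFn_tuple g] with x h1 h2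
  rw [h1, h2]

/-- A separation-preserving operator `S` satisfies `sup_j |S g_j| = |S (sup_j |g_j|)|`. Both sides
depend continuously on `g`, are additive on functions with disjoint supports, and agree on
functions that are constant on a set and zero off it. -/
theorem IsSeparationPreserving.pointwiseNorm_mapComponents (hp : p ≠ ∞)
    {S : Lp 𝕜 p μ →L[𝕜] Lp 𝕜 p μ} (hS : IsSeparationPreserving S) (g : Lp (J → 𝕜) p μ) :
    Lp.pointwiseNorm 𝕜 (Lp.mapComponents J S g) =
      Lp.pointwiseNorm 𝕜 (S (Lp.pointwiseNorm 𝕜 g)) := by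
  induction g using Lp.induction hp with
  | indicatorConst c hs hμs =>
    rename_i s
    rw [Lp.simpleFunc.coe_indicatorConst]
    set e : Lp 𝕜 p μ := indicatorConstLp p hs hμs.ne 1 with he
    have hcomp : ∀ j, Lp.component j (indicatorConstLp p hs hμs.ne c) = c j • e := by
      intro j
      refine Lp.ext ?_
      filter_upwards [Lp.coeFn_component j (indicatorConstLp p hs hμs.ne c),
        indicatorConstLp_coeFn (p := p) (hs := hs) (hμs := hμs.ne) (c := c),
        indicatorConstLp_coeFn (p := p) (hs := hs) (hμs := hμs.ne) (c := (1 : 𝕜)),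
        Lp.coeFn_smul (c j) e] with x h1 h2 h3 h4
      rw [h1, h2, h4, Pi.smul_apply, he, h3]
      by_cases hx : x ∈ s <;> simp [hx]
    have hnorm : Lp.pointwiseNorm 𝕜 (indicatorConstLp p hs hμs.ne c) = ((‖c‖ : ℝ) : 𝕜) • e := by
      refine Lp.ext ?_
      filter_upwards [Lp.coeFn_pointwiseNorm (𝕜 := 𝕜) (indicatorConstLp p hs hμs.ne c),
        indicatorConstLp_coeFn (p := p) (hs := hs) (hμs := hμs.ne) (c := c),
        indicatorConstLp_coeFn (p := p) (hs := hs) (hμs := hμs.ne) (c := (1 : 𝕜)),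
        Lp.coeFn_smul ((‖c‖ : ℝ) : 𝕜) e] with x h1 h2 h3 h4
      rw [h1, h2, h4, Pi.smul_apply, he, h3]
      by_cases hx : x ∈ s <;> simp [hx]
    refine Lp.ext ?_
    have hae : ∀ᵐ x ∂μ, ∀ j, (c j • S e : Lp 𝕜 p μ) x = c j * S e x :=
      ae_all_iff.2 fun j => Lp.coeFn_smul (c j) (S e)
    filter_upwards [Lp.coeFn_pointwiseNorm (𝕜 := 𝕜)
        (Lp.mapComponents J S (indicatorConstLp p hs hμs.ne c)),
      Lp.coeFn_pointwiseNorm (𝕜 := 𝕜) (S (Lp.pointwiseNorm 𝕜 (indicatorConstLp p hs hμs.ne c))),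
      Lp.coeFn_mapComponents S (indicatorConstLp p hs hμs.ne c), hae,
      Lp.coeFn_smul ((‖c‖ : ℝ) : 𝕜) (S e)] with x h1 h2 h3 h4 h5
    have h6 : (fun j => S (Lp.component j (indicatorConstLp p hs hμs.ne c)) x) = S e x • c := by
      ext j
      rw [hcomp, map_smul, h4, Pi.smul_apply, smul_eq_mul, mul_comm]
    rw [h1, h2, h3, h6, hnorm, map_smul, h5, Pi.smul_apply, norm_smul, norm_smul]
    simp [mul_comm]
  | add hf hg hfg ihf ihg =>
    rename_i f g
    set F := hf.toLp f
    set H := hg.toLp g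
    have hdisj : ∀ᵐ x ∂μ, F x = 0 ∨ H x = 0 := by
      filter_upwards [hf.coeFn_toLp, hg.coeFn_toLp] with x h1 h2
      rw [h1, h2]
      by_contra! hc
      exact Set.disjoint_left.1 hfg hc.1 hc.2
    have hS' : ∀ᵐ x ∂μ, S (Lp.pointwiseNorm 𝕜 F) x = 0 ∨ S (Lp.pointwiseNorm 𝕜 H) x = 0 := by
      refine hS _ _ ?_
      filter_upwards [hdisj, Lp.coeFn_pointwiseNorm (𝕜 := 𝕜) F,
        Lp.coeFn_pointwiseNorm (𝕜 := 𝕜) H] with x h1 h2 h3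
      rw [h2, h3]
      exact h1.imp (fun h => by simp [h]) fun h => by simp [h]
    have hnorm : Lp.pointwiseNorm 𝕜 (F + H) = Lp.pointwiseNorm 𝕜 F + Lp.pointwiseNorm 𝕜 H := by
      refine Lp.ext ?_
      filter_upwards [hdisj, Lp.coeFn_pointwiseNorm (𝕜 := 𝕜) F,
        Lp.coeFn_pointwiseNorm (𝕜 := 𝕜) H, Lp.coeFn_pointwiseNorm (𝕜 := 𝕜) (F + H),
        Lp.coeFn_add F H, Lp.coeFn_add (Lp.pointwiseNorm 𝕜 F) (Lp.pointwiseNorm 𝕜 H)]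
        with x h1 h2 h3 h4 h5 h6
      rw [h4, h5, h6, Pi.add_apply, Pi.add_apply, h2, h3]
      rcases h1 with h | h <;> simp [h]
    refine Lp.ext ?_
    rw [map_add, hnorm, map_add]
    set A := Lp.mapComponents J S F
    set B := Lp.mapComponents J S H
    set a := S (Lp.pointwiseNorm 𝕜 F)
    set b := S (Lp.pointwiseNorm 𝕜 H)
    have hA := Lp.coeFn_pointwiseNorm (𝕜 := 𝕜) A
    have hB := Lp.coeFn_pointwiseNorm (𝕜 := 𝕜) B
    rw [ihf] at hA
    rw [ihg] at hB
    filter_upwards [hS', hA, hB, Lp.coeFn_pointwiseNorm (𝕜 := 𝕜) a,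
      Lp.coeFn_pointwiseNorm (𝕜 := 𝕜) b, Lp.coeFn_pointwiseNorm (𝕜 := 𝕜) (A + B),
      Lp.coeFn_pointwiseNorm (𝕜 := 𝕜) (a + b), Lp.coeFn_add A B, Lp.coeFn_add a b]
      with x h1 h2 h3 h4 h5 h6 h7 h8 h9
    rw [h2, RCLike.ofReal_inj] at h4
    rw [h3, RCLike.ofReal_inj] at h5
    rw [h6, h7, h8, h9, Pi.add_apply, Pi.add_apply, RCLike.ofReal_inj]
    -- where `a` vanishes so does `A`, by the induction hypothesis; likewise for `b` and `B`
    rcases h1 with h | h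
    · rw [h, norm_zero, norm_eq_zero] at h4
      rw [h, h4, zero_add, zero_add, h5]
    · rw [h, norm_zero, norm_eq_zero] at h5
      rw [h, h5, add_zero, add_zero, h4]
  | isClosed =>
    exact isClosed_eq (Lp.continuous_pointwiseNorm.comp (Lp.mapComponents J S).continuous)
      (Lp.continuous_pointwiseNorm.comp (S.continuous.comp Lp.continuous_pointwiseNorm))

theorem IsSeparationPreserving.norm_tuple_le (hp : p ≠ ∞)
    {S : Lp 𝕜 p μ →L[𝕜] Lp 𝕜 p μ} (hS : IsSeparationPreserving S) (g : J → Lp 𝕜 p μ) :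
    ‖Lp.tuple fun j => S (g j)‖ ≤ ‖S‖ * ‖Lp.tuple g‖ := by
  have h := congrArg norm (hS.pointwiseNorm_mapComponents hp (Lp.tuple g))
  rw [Lp.norm_pointwiseNorm, Lp.norm_pointwiseNorm, Lp.mapComponents_apply] at h
  simp only [Lp.component_tuple] at h
  rw [h, ← Lp.norm_pointwiseNorm (𝕜 := 𝕜) (Lp.tuple g)]
  exact S.le_opNorm _

end SeparationPreserving

/-! ### Approximation by compactly supported functions -/

section Approximation

/-- Integrable functions on a locally compact space are approximated by compactly supported
continuous functions. Unlike for
`MeasureTheory.Integrable.exists_hasCompactSupport_integral_sub_le`, the space need not be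
normal. -/
theorem exists_hasCompactSupport_eLpNorm_one_sub_le {X E : Type*} [TopologicalSpace X]
    [LocallyCompactSpace X] [T2Space X] [MeasurableSpace X] [BorelSpace X] {m : Measure X}
    [m.Regular] [NormedAddCommGroup E] [NormedSpace ℝ E] {f : X → E} (hf : MemLp f 1 m)
    {ε : ℝ≥0∞} (hε : ε ≠ 0) :
    ∃ g : X → E, eLpNorm (f - g) 1 m ≤ ε ∧ Continuous g ∧ HasCompactSupport g ∧ Integrable g m := by
  apply hf.induction_dense ENNReal.one_ne_top
    (fun g => Continuous g ∧ HasCompactSupport g ∧ Integrable g m) _ _ _ hε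
  rotate_left
  · rintro f g ⟨hf, hf', hf''⟩ ⟨hg, hg', hg''⟩
    exact ⟨hf.add hg, hf'.add hg', hf''.add hg''⟩
  · rintro f ⟨_, _, hf⟩
    exact hf.aestronglyMeasurable
  intro c t ht htm ε hε
  obtain ⟨η, hη0, hη⟩ := ENNReal.exists_pos_mul_lt
    (ENNReal.mul_ne_top ENNReal.ofNat_ne_top enorm_ne_top : 2 * ‖c‖ₑ ≠ ∞) hε
  obtain ⟨v, htv, hv, -, hmv⟩ := ht.exists_isOpen_sdiff_lt htm.ne hη0.ne'
  obtain ⟨s, hst, hs, hms⟩ := ht.exists_isCompact_sdiff_lt htm.ne hη0.ne'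
  obtain ⟨φ, hφ1, hφ0, hφc, hφI⟩ := exists_continuous_one_zero_of_isCompact hs hv.isClosed_compl
    (Set.disjoint_compl_right_iff_subset.2 (hst.trans htv))
  have hcont : Continuous fun x => φ x • c := φ.continuous.smul continuous_const
  have hsupp : HasCompactSupport fun x => φ x • c := hφc.smul_right
  refine ⟨fun x => φ x • c, ?_, hcont, hsupp, hcont.integrable_of_hasCompactSupport hsupp⟩
  have hbound : ∀ x, ‖((fun x => φ x • c) - t.indicator fun _ => c) x‖ₑ ≤
      ‖((v \ t) ∪ (t \ s)).indicator (fun _ => c) x‖ₑ := by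
    intro x
    have h1 : ‖φ x‖ ≤ 1 := by
      rw [Real.norm_eq_abs, abs_of_nonneg (hφI x).1]
      exact (hφI x).2
    have h2 : ‖1 - φ x‖ ≤ 1 := by
      rw [Real.norm_eq_abs, abs_of_nonneg (sub_nonneg.2 (hφI x).2)]
      linarith [(hφI x).1]
    rw [← ofReal_norm, ← ofReal_norm]
    refine ENNReal.ofReal_le_ofReal ?_
    by_cases hxs : x ∈ s
    · simp [hst hxs, hφ1 hxs, hxs]
    by_cases hxt : x ∈ t
    · have : φ x • c - c = -((1 - φ x) • c) := by rw [sub_smul, one_smul, neg_sub]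
      simp only [Pi.sub_apply, hxt, Set.indicator_of_mem, this, norm_neg]
      rw [Set.indicator_of_mem (show x ∈ (v \ t) ∪ (t \ s) from Or.inr ⟨hxt, hxs⟩), norm_smul]
      exact mul_le_of_le_one_left (norm_nonneg _) h2
    by_cases hxv : x ∈ v
    · simp only [Pi.sub_apply, hxt, not_false_eq_true, Set.indicator_of_notMem, sub_zero]
      rw [Set.indicator_of_mem (show x ∈ (v \ t) ∪ (t \ s) from Or.inl ⟨hxv, hxt⟩), norm_smul]
      exact mul_le_of_le_one_left (norm_nonneg _) h1
    · simp [hxt, hφ0 hxv]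
  refine (eLpNorm_mono_enorm hbound).trans ((eLpNorm_indicator_const_le _ _).trans ?_)
  simp only [ENNReal.toReal_one, div_one, ENNReal.rpow_one]
  calc ‖c‖ₑ * m ((v \ t) ∪ (t \ s)) ≤ ‖c‖ₑ * (η + η) := by
        gcongr
        exact (measure_union_le _ _).trans (add_le_add hmv.le hms.le)
    _ = η * (2 * ‖c‖ₑ) := by ring
    _ ≤ ε := hη.le

theorem exists_hasCompactSupport_integral_norm_sub_le {X E : Type*} [TopologicalSpace X]
    [LocallyCompactSpace X] [T2Space X] [MeasurableSpace X] [BorelSpace X] {m : Measure X}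
    [m.Regular] [NormedAddCommGroup E] [NormedSpace ℝ E] {f : X → E} (hf : Integrable f m)
    {ε : ℝ} (hε : 0 < ε) :
    ∃ g : X → E, ∫ x, ‖f x - g x‖ ∂m ≤ ε ∧ Continuous g ∧ HasCompactSupport g ∧
      Integrable g m := by
  obtain ⟨g, hg, hgc, hgs, hgi⟩ := exists_hasCompactSupport_eLpNorm_one_sub_le
    (memLp_one_iff_integrable.2 hf) (ENNReal.ofReal_pos.2 hε).ne'
  refine ⟨g, ?_, hgc, hgs, hgi⟩
  rw [eLpNorm_one_eq_lintegral_enorm] at hg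
  refine (integral_norm_eq_lintegral_enorm (hf.sub hgi).aestronglyMeasurable).trans_le ?_
  exact ENNReal.toReal_le_of_le_ofReal hε.le hg

end Approximation

section Convolution

variable {G 𝕜 X : Type*} [RCLike 𝕜] [AddCommGroup G] [TopologicalSpace G]
  [IsTopologicalAddGroup G] [LocallyCompactSpace G] [T2Space G] [MeasurableSpace G] [BorelSpace G]
  {m : Measure G} [m.IsAddHaarMeasure] [m.Regular]

omit [AddCommGroup G] [IsTopologicalAddGroup G] [m.IsAddHaarMeasure] in
/-- A continuous bounded function times an integrable function is Bochner integrable, even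
if its values do not lie in a separable space. -/
theorem integrable_smul_of_continuous_bounded [NormedAddCommGroup X] [NormedSpace 𝕜 X] {k : G → 𝕜}
    (hk : Integrable k m) {F : G → X} (hF : Continuous F) {M : ℝ} (hM : ∀ u, ‖F u‖ ≤ M) :
    Integrable (fun u => k u • F u) m := by
  have happ : ∀ n : ℕ, ∃ g : G → 𝕜, eLpNorm (k - g) 1 m ≤ ((n : ℝ≥0∞) + 1)⁻¹ ∧ Continuous g ∧
      HasCompactSupport g ∧ Integrable g m := fun n =>
    exists_hasCompactSupport_eLpNorm_one_sub_le (memLp_one_iff_integrable.2 hk) (by simp)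
  choose g hg hgc hgs hgi using happ
  have hlim : Filter.Tendsto (fun n => eLpNorm (g n - k) 1 m) Filter.atTop (nhds 0) := by
    refine tendsto_of_tendsto_of_tendsto_of_le_of_le tendsto_const_nhds
      ENNReal.tendsto_inv_nat_nhds_zero (fun n => zero_le) fun n => ?_
    rw [eLpNorm_sub_comm]
    exact (hg n).trans (ENNReal.inv_le_inv.2 le_self_add)
  obtain ⟨ns, -, hns⟩ := (tendstoInMeasure_of_tendsto_eLpNorm one_ne_zero
    (fun n => (hgi n).aestronglyMeasurable) hk.aestronglyMeasurable hlim).exists_seq_tendsto_ae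
  have hmeas : AEStronglyMeasurable (fun u => k u • F u) m := by
    refine aestronglyMeasurable_of_tendsto_ae Filter.atTop (f := fun n u => g (ns n) u • F u)
      (fun n => ?_) ?_
    · exact (((hgc _).smul hF).stronglyMeasurable_of_hasCompactSupport
        (hgs _).smul_right).aestronglyMeasurable
    · filter_upwards [hns] with u hu
      exact hu.smul_const _
  refine (hk.norm.mul_const M).mono' hmeas (Filter.Eventually.of_forall fun u => ?_)
  rw [norm_smul]
  exact mul_le_mul_of_nonneg_left (hM u) (norm_nonneg _)

omit [LocallyCompactSpace G] [T2Space G] [m.IsAddHaarMeasure] [m.Regular] in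
theorem integrable_mul_comp_sub {k : G → 𝕜} (hk : Integrable k m)
    {w : G → 𝕜} (hw : Measurable w) (hw1 : ∀ u, ‖w u‖ ≤ 1) (v : G) :
    Integrable (fun u => k u * w (v - u)) m :=
  hk.mul_bdd (c := 1) (hw.comp (measurable_const_sub v)).aestronglyMeasurable
    (Filter.Eventually.of_forall fun u => hw1 (v - u))

/-- The convolution of an integrable function with a bounded measurable one is continuous: it is a
uniform limit of convolutions with compactly supported continuous kernels. -/
theorem continuous_convolution_of_integrable_of_bounded {k : G → 𝕜} (hk : Integrable k m)
    {w : G → 𝕜} (hw : Measurable w) (hwi : Integrable w m) (hw1 : ∀ u, ‖w u‖ ≤ 1) :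
    Continuous (convolution k w (ContinuousLinearMap.mul 𝕜 𝕜) m) := by
  have happ : ∀ n : ℕ, ∃ g : G → 𝕜, ∫ u, ‖k u - g u‖ ∂m ≤ 1 / ((n : ℝ) + 1) ∧ Continuous g ∧
      HasCompactSupport g ∧ Integrable g m := fun n =>
    exists_hasCompactSupport_integral_norm_sub_le hk (by positivity)
  choose g hg hgc hgs hgi using happ
  have hunif : TendstoUniformly
      (fun n => convolution (g n) w (ContinuousLinearMap.mul 𝕜 𝕜) m)
      (convolution k w (ContinuousLinearMap.mul 𝕜 𝕜) m) Filter.atTop := by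
    rw [Metric.tendstoUniformly_iff]
    intro ε hε
    filter_upwards [tendsto_one_div_add_atTop_nhds_zero_nat.eventually (gt_mem_nhds hε)]
      with n hn v
    refine lt_of_le_of_lt ?_ hn
    rw [dist_eq_norm]
    simp only [convolution, ContinuousLinearMap.mul_apply']
    rw [← integral_sub (integrable_mul_comp_sub hk hw hw1 v)
      (integrable_mul_comp_sub (hgi n) hw hw1 v)]
    refine (norm_integral_le_of_norm_le (hk.sub (hgi n)).norm
      (Filter.Eventually.of_forall fun u => ?_)).trans (hg n)
    rw [← sub_mul, norm_mul]
    exact mul_le_of_le_one_right (norm_nonneg _) (hw1 _)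
  exact hunif.continuous (Filter.Frequently.of_forall fun n =>
    (hgs n).continuous_convolution_left _ (hgc n) hwi.locallyIntegrable)

end Convolution

/-! ### The maximal inequality for functions with values in a space of simple functions -/

section SimpleFunctions

theorem lintegral_comp_simpleFunc {Ω E : Type*} [MeasurableSpace Ω] (μ : Measure Ω)
    (s : SimpleFunc Ω E) (Φ : E → ℝ≥0∞) :
    ∫⁻ x, Φ (s x) ∂μ = ∑ y ∈ s.range, Φ y * μ (s ⁻¹' {y}) := by
  rw [← SimpleFunc.map_lintegral, ← SimpleFunc.lintegral_eq_lintegral]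
  rfl

theorem measurable_lintegral_simpleFunc {G Ω E : Type*} [MeasurableSpace G] [MeasurableSpace Ω]
    (μ : Measure Ω) (s : SimpleFunc Ω E) {Φ : G → E → ℝ≥0∞}
    (hΦ : ∀ y, Measurable fun v => Φ v y) : Measurable fun v => ∫⁻ x, Φ v (s x) ∂μ := by
  simp only [lintegral_comp_simpleFunc]
  exact Finset.measurable_fun_sum _ fun y _ => (hΦ y).mul_const _

theorem lintegral_lintegral_simpleFunc {G Ω E : Type*} [MeasurableSpace G] [MeasurableSpace Ω]
    (m : Measure G) (μ : Measure Ω) (s : SimpleFunc Ω E) {Φ : G → E → ℝ≥0∞}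
    (hΦ : ∀ y, Measurable fun v => Φ v y) :
    ∫⁻ v, ∫⁻ x, Φ v (s x) ∂μ ∂m = ∑ y ∈ s.range, (∫⁻ v, Φ v y ∂m) * μ (s ⁻¹' {y}) := by
  simp only [lintegral_comp_simpleFunc]
  rw [lintegral_finsetSum _ fun y _ => (hΦ y).mul_const _]
  exact Finset.sum_congr rfl fun y _ => lintegral_mul_const _ (hΦ y)

theorem eLpNorm_maximalConvolution_le {G 𝕜 ι : Type*} [AddCommGroup G] [MeasurableSpace G]
    [RCLike 𝕜] {p : ℝ≥0∞} {m : Measure G} {k : ι → G → 𝕜}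
    (hN : maximalConvolutionNorm p m k < ∞) {f : G → 𝕜} (hf : MemLp f p m) :
    eLpNorm (maximalConvolution m k f) p m ≤ maximalConvolutionNorm p m k * eLpNorm f p m := by
  rcases eq_or_ne (eLpNorm f p m) 0 with h0 | h0
  · obtain ⟨C, hC, -⟩ := sInf_lt_iff.1 hN
    simpa [h0] using hC f hf
  · rw [← ENNReal.div_le_iff h0 hf.eLpNorm_ne_top]
    exact le_sInf fun C hC => (ENNReal.div_le_iff h0 hf.eLpNorm_ne_top).2 (hC f hf)

theorem enorm_pi_le {J E : Type*} [Fintype J] [NormedAddCommGroup E] (a : J → E) :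
    ‖a‖ₑ ≤ ⨆ j, ‖a j‖ₑ := by
  rcases isEmpty_or_nonempty J with hJ | hJ
  · simp [Subsingleton.elim a 0]
  · obtain ⟨j, hj⟩ := Finite.exists_max fun j => ‖a j‖
    refine le_trans ?_ (le_iSup _ j)
    exact enorm_le_iff_norm_le.2 ((pi_norm_le_iff_of_nonneg (norm_nonneg _)).2 hj)

variable {G Ω 𝕜 ι : Type*} [RCLike 𝕜] [AddCommGroup G] [TopologicalSpace G]
  [IsTopologicalAddGroup G] [LocallyCompactSpace G] [T2Space G] [MeasurableSpace G] [BorelSpace G]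
  {m : Measure G} [m.IsAddHaarMeasure] [m.Regular] [MeasurableSpace Ω] {μ : Measure Ω}
  {p : ℝ≥0∞} [Fact (1 ≤ p)] {k : ι → G → 𝕜}

omit [Fact (1 ≤ p)] in
theorem measurable_enorm_convolution_rpow (hk : ∀ j, Integrable (k j) m) (J : Finset ι)
    {I : Type*} [Fintype I] {w : I → G → 𝕜} (hw : ∀ i, Measurable (w i))
    (hwi : ∀ i, Integrable (w i) m) (hw1 : ∀ i u, ‖w i u‖ ≤ 1) (y : I → 𝕜) :
    Measurable fun v => ‖fun j : J => ∑ i,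
      convolution (k j) (w i) (ContinuousLinearMap.mul 𝕜 𝕜) m v * y i‖ₑ ^ p.toReal := by
  have hc : Continuous fun v => fun j : J => ∑ i,
      convolution (k j) (w i) (ContinuousLinearMap.mul 𝕜 𝕜) m v * y i :=
    continuous_pi fun j => continuous_finsetSum _ fun i _ =>
      (continuous_convolution_of_integrable_of_bounded (hk j) (hw i) (hwi i)
        (hw1 i)).mul continuous_const
  exact hc.enorm.measurable.pow_const _

/-- The scalar maximal inequality for the kernels `k_j` extends to functions
`v ↦ ∑ i, w i v • s i` with values in the simple functions on `Ω`: apply it on each of the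
finitely many level sets of `s`. -/
theorem lintegral_convolution_simpleFunc_le (hp : p ≠ ∞) (hk : ∀ j, Integrable (k j) m)
    (hN : maximalConvolutionNorm p m k < ∞) (J : Finset ι) {I : Type*} [Fintype I]
    {w : I → G → 𝕜} (hw : ∀ i, Measurable (w i)) (hwi : ∀ i, Integrable (w i) m)
    (hwp : ∀ i, MemLp (w i) p m)
    (hw1 : ∀ i u, ‖w i u‖ ≤ 1) (s : SimpleFunc Ω (I → 𝕜)) :
    ∫⁻ v, ∫⁻ x, ‖fun j : J => ∑ i,
        convolution (k j) (w i) (ContinuousLinearMap.mul 𝕜 𝕜) m v * s x i‖ₑ ^ p.toReal ∂μ ∂m ≤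
      maximalConvolutionNorm p m k ^ p.toReal *
        ∫⁻ v, ∫⁻ x, ‖∑ i, w i v * s x i‖ₑ ^ p.toReal ∂μ ∂m := by
  have hp0 : p ≠ 0 := (zero_lt_one.trans_le Fact.out).ne'
  have hp0' : 0 < p.toReal := ENNReal.toReal_pos hp0 hp
  rw [lintegral_lintegral_simpleFunc m μ s (Φ := fun v y => ‖fun j : J => ∑ i,
      convolution (k j) (w i) (ContinuousLinearMap.mul 𝕜 𝕜) m v * y i‖ₑ ^ p.toReal)
      (measurable_enorm_convolution_rpow hk J hw hwi hw1),
    lintegral_lintegral_simpleFunc m μ s (Φ := fun v y => ‖∑ i, w i v * y i‖ₑ ^ p.toReal) fun y =>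
      (measurable_enorm.comp (Finset.measurable_fun_sum _
        fun i _ => (hw i).mul_const _)).pow_const _, Finset.mul_sum]
  refine Finset.sum_le_sum fun y _ => ?_
  rw [← mul_assoc]
  gcongr
  have hf : MemLp (fun v => ∑ i, w i v * y i) p m :=
    memLp_finsetSum _ fun i _ => (hwp i).mul_const (y i)
  have h1 := ENNReal.rpow_le_rpow (eLpNorm_maximalConvolution_le hN hf) hp0'.le
  rw [ENNReal.mul_rpow_of_nonneg _ _ hp0'.le,
    eLpNorm_eq_lintegral_rpow_enorm_toReal hp0 hp, eLpNorm_eq_lintegral_rpow_enorm_toReal hp0 hp,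
    ← ENNReal.rpow_mul, ← ENNReal.rpow_mul, one_div_mul_cancel hp0'.ne', ENNReal.rpow_one,
    ENNReal.rpow_one] at h1
  refine le_trans (lintegral_mono fun v => ?_) h1
  gcongr
  refine (enorm_pi_le _).trans (iSup_le fun j => ?_)
  rw [enorm_eq_self, maximalConvolution]
  refine le_trans (le_of_eq ?_) (le_iSup _ (j : ι))
  congr 1
  simp only [convolution, ContinuousLinearMap.mul_apply', Finset.mul_sum, ← mul_assoc]
  rw [integral_finsetSum _ fun i _ =>
    (integrable_mul_comp_sub (hk j) (hw i) (hw1 i) v).mul_const _]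
  exact Finset.sum_congr rfl fun i _ => (integral_mul_const _ _).symm

end SimpleFunctions

/-! ### Step functions with values in `L^p` -/

section StepFunctions

variable {G Ω 𝕜 : Type*} [RCLike 𝕜] [TopologicalSpace G] [T2Space G] [MeasurableSpace G]
  [BorelSpace G] [MeasurableSpace Ω] {μ : Measure Ω} {p : ℝ≥0∞} [Fact (1 ≤ p)]

theorem Lp.norm_component_le {J : Type*} [Fintype J] (j : J) (g : Lp (J → 𝕜) p μ) :
    ‖Lp.component j g‖ ≤ ‖g‖ := by
  refine Lp.norm_le_norm_of_ae_le ?_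
  filter_upwards [Lp.coeFn_component j g] with x hx
  rw [hx]
  exact norm_le_pi_norm (g x) j

theorem Lp.exists_simpleFunc_component_sub_le (hp : p ≠ ∞) {J : Type*} [Fintype J]
    (g : J → Lp 𝕜 p μ) {ε : ℝ} (hε : 0 < ε) :
    ∃ (s : SimpleFunc Ω (J → 𝕜)) (e : J → Lp 𝕜 p μ), (∀ j, ∀ᵐ x ∂μ, e j x = s x j) ∧
      ∀ j, ‖g j - e j‖ ≤ ε := by
  obtain ⟨s, hs, hsm⟩ := (Lp.memLp (Lp.tuple g)).exists_simpleFunc_eLpNorm_sub_lt hp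
    (ENNReal.ofReal_pos.2 hε).ne'
  refine ⟨s, fun j => Lp.component j (hsm.toLp s), fun j => ?_, fun j => ?_⟩
  · filter_upwards [Lp.coeFn_component j (hsm.toLp s), hsm.coeFn_toLp] with x h1 h2
    rw [h1, h2]
  · rw [← Lp.component_tuple g j, ← map_sub]
    refine (Lp.norm_component_le j _).trans ?_
    conv_lhs => rw [← Lp.toLp_coeFn (Lp.tuple g) (Lp.memLp _), ← MemLp.toLp_sub, Lp.norm_toLp]
    exact ENNReal.toReal_le_of_le_ofReal hε.le hs.le

/-- A continuous `L^p`-valued function is uniformly close on a compact set `W` to a step function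
supported in `W` whose values are classes of simple functions on `Ω`. The values are recorded by a
single simple function `s` into a finite power of the scalar field. -/
theorem exists_step_approx (hp : p ≠ ∞) {W : Set G} (hW : IsCompact W) {F : G → Lp 𝕜 p μ}
    (hF : Continuous F) {ε : ℝ} (hε : 0 < ε) :
    ∃ (n : ℕ) (s : SimpleFunc Ω (Fin n → 𝕜)) (e : Fin n → Lp 𝕜 p μ) (A : Fin n → Set G),
      (∀ i, ∀ᵐ x ∂μ, e i x = s x i) ∧ (∀ i, MeasurableSet (A i)) ∧ (∀ i, A i ⊆ W) ∧
      ∀ v ∈ W, ‖F v - ∑ i, (A i).indicator (1 : G → 𝕜) v • e i‖ ≤ ε := by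
  classical
  obtain ⟨t, -, ht⟩ := hW.elim_nhds_subcover (fun x => F ⁻¹' Metric.ball (F x) (ε / 2))
    fun x _ => hF.continuousAt.preimage_mem_nhds (Metric.ball_mem_nhds _ (half_pos hε))
  set c : Fin t.card → G := fun i => t.equivFin.symm i with hc
  obtain ⟨s, e, hse, he⟩ := Lp.exists_simpleFunc_component_sub_le hp (fun i => F (c i)) (half_pos hε)
  set B : Fin t.card → Set G := fun i => W ∩ F ⁻¹' Metric.ball (F (c i)) (ε / 2) with hB
  have hBm : ∀ i, MeasurableSet (B i) := fun i =>
    hW.measurableSet.inter (Metric.isOpen_ball.preimage hF).measurableSet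
  have hBW : ∀ i, B i ⊆ W := fun i => Set.inter_subset_left
  refine ⟨t.card, s, e, fun i => B i \ ⋃ j < i, B j, hse, fun i => ?_,
    fun i => Set.sdiff_subset.trans (hBW i), fun v hv => ?_⟩
  · exact (hBm i).diff (MeasurableSet.biUnion (Set.to_countable _) fun j _ => hBm j)
  · obtain ⟨x, hx, hvx⟩ := Set.mem_iUnion₂.1 (ht hv)
    have hne : (Finset.univ.filter fun i => v ∈ B i).Nonempty :=
      ⟨t.equivFin ⟨x, hx⟩, by simpa [hB, hc] using ⟨hv, hvx⟩⟩
    -- `i` is the first index with `v ∈ B i`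
    obtain ⟨i, hi, hmin⟩ := Finset.exists_min_image _ id hne
    simp only [Finset.mem_filter, Finset.mem_univ, true_and, id] at hi hmin
    rw [Finset.sum_eq_single i, Set.indicator_of_mem, Pi.one_apply, one_smul]
    · calc ‖F v - e i‖ ≤ ‖F v - F (c i)‖ + ‖F (c i) - e i‖ := norm_sub_le_norm_sub_add_norm_sub ..
        _ ≤ ε / 2 + ε / 2 := add_le_add (by
            have := hi.2
            rw [Set.mem_preimage, mem_ball_iff_norm] at this
            exact this.le) (he i)
        _ = ε := add_halves ε
    · refine ⟨hi, ?_⟩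
      simp only [Set.mem_iUnion, not_exists]
      exact fun j hj hvj => absurd (hmin j hvj) (not_le.2 hj)
    · intro j _ hji
      rw [Set.indicator_of_notMem, zero_smul]
      rintro ⟨hvj, hvn⟩
      exact hvn (Set.mem_iUnion₂.2 ⟨i, lt_of_le_of_ne (hmin j hvj) hji.symm, hi⟩)
    · simp

omit [Fact (1 ≤ p)] in
theorem Lp.coeFn_sum_smul {I : Type*} [Fintype I] {s : Ω → I → 𝕜} {e : I → Lp 𝕜 p μ}
    (hse : ∀ i, ∀ᵐ x ∂μ, e i x = s x i) (a : I → 𝕜) :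
    ∀ᵐ x ∂μ, (∑ i, a i • e i : Lp 𝕜 p μ) x = ∑ i, a i * s x i := by
  have h1 : ∀ᵐ x ∂μ, ∀ i, (a i • e i : Lp 𝕜 p μ) x = a i * e i x :=
    ae_all_iff.2 fun i => Lp.coeFn_smul (a i) (e i)
  filter_upwards [Lp.coeFn_finsetSum Finset.univ (fun i => a i • e i), h1, ae_all_iff.2 hse]
    with x h2 h3 h4
  rw [h2, Finset.sum_apply]
  simp [h3, h4]

theorem Lp.enorm_rpow_toReal {E : Type*} [NormedAddCommGroup E] (hp : p ≠ ∞) (g : Lp E p μ)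
    {h : Ω → E} (hgh : g =ᵐ[μ] h) : ‖g‖ₑ ^ p.toReal = ∫⁻ x, ‖h x‖ₑ ^ p.toReal ∂μ := by
  have hp0 : p ≠ 0 := (zero_lt_one.trans_le Fact.out).ne'
  rw [Lp.enorm_def, eLpNorm_congr_ae hgh, eLpNorm_eq_lintegral_rpow_enorm_toReal hp0 hp,
    ← ENNReal.rpow_mul, one_div_mul_cancel (ENNReal.toReal_pos hp0 hp).ne', ENNReal.rpow_one]

end StepFunctions

/-! ### Transference -/

section UniformBound

variable {G 𝕜 X : Type*} [NontriviallyNormedField 𝕜] [NormedAddCommGroup X] [NormedSpace 𝕜 X]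
  {R : G → X →L[𝕜] X}

theorem norm_le_toReal_supOpNorm (hbdd : supOpNorm R < ∞) (u : G) :
    ‖R u‖ ≤ (supOpNorm R).toReal := by
  rw [← toReal_enorm]
  exact ENNReal.toReal_mono hbdd.ne (le_iSup (fun u => ‖R u‖ₑ) u)

theorem norm_apply_le_toReal_supOpNorm (hbdd : supOpNorm R < ∞) (f : X) (u : G) :
    ‖R u f‖ ≤ (supOpNorm R).toReal * ‖f‖ :=
  (R u).le_of_opNorm_le (norm_le_toReal_supOpNorm hbdd u) f

end UniformBound

section Transference

variable {G Ω 𝕜 ι : Type*} [RCLike 𝕜] [AddCommGroup G] [TopologicalSpace G]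
  [IsTopologicalAddGroup G] [LocallyCompactSpace G] [T2Space G] [MeasurableSpace G] [BorelSpace G]
  {m : Measure G} [m.IsAddHaarMeasure] [m.Regular] [MeasurableSpace Ω] {μ : Measure Ω}
  {p : ℝ≥0∞} [Fact (1 ≤ p)] {k : ι → G → 𝕜} {R : G → Lp 𝕜 p μ →L[𝕜] Lp 𝕜 p μ}

/-- If a step function `H` has norm at most `B` and is supported in `W`, then the norm of
`sup_j |k_j * H|` is at most `N (1 + δ) B` at some point of any `V` with `m W ≤ (1 + δ) m V`:
average the maximal inequality for `H` over `V`. -/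
theorem exists_norm_convolution_le (hp : p ≠ ∞) (hk : ∀ j, Integrable (k j) m)
    (hN : maximalConvolutionNorm p m k < ∞) (J : Finset ι) {n : ℕ} {s : SimpleFunc Ω (Fin n → 𝕜)}
    {e : Fin n → Lp 𝕜 p μ} (hse : ∀ i, ∀ᵐ x ∂μ, e i x = s x i) {A : Fin n → Set G}
    (hA : ∀ i, MeasurableSet (A i)) {V W : Set G} (hV : IsCompact V) (hW : IsCompact W)
    (hAW : ∀ i, A i ⊆ W) {δ B : ℝ} (hδ : 0 ≤ δ) (hV0 : m V ≠ 0)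
    (hVW : m W ≤ ENNReal.ofReal (1 + δ) * m V)
    (hB : 0 ≤ B) (hH : ∀ v ∈ W, ‖∑ i, (A i).indicator (1 : G → 𝕜) v • e i‖ ≤ B) :
    ∃ v ∈ V, ‖Lp.tuple fun j : J => ∑ i, convolution (k j) ((A i).indicator (1 : G → 𝕜))
      (ContinuousLinearMap.mul 𝕜 𝕜) m v • e i‖ ≤
        (maximalConvolutionNorm p m k).toReal * ((1 + δ) * B) := by
  have hp0 : p ≠ 0 := (zero_lt_one.trans_le Fact.out).ne'
  have hq : 0 < p.toReal := ENNReal.toReal_pos hp0 hp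
  have hq1 : 1 ≤ p.toReal := by
    rw [← ENNReal.toReal_one]
    exact ENNReal.toReal_mono hp Fact.out
  set N := maximalConvolutionNorm p m k
  set w : Fin n → G → 𝕜 := fun i => (A i).indicator 1 with hw_def
  have hAtop : ∀ i, m (A i) ≠ ∞ := fun i => ((measure_mono (hAW i)).trans_lt hW.measure_lt_top).ne
  have hw : ∀ i, Measurable (w i) := fun i => measurable_one.indicator (hA i)
  have hwp : ∀ i (r : ℝ≥0∞), MemLp (w i) r m := fun i r =>
    memLp_indicator_const r (hA i) (1 : 𝕜) (Or.inr (hAtop i))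
  have hwi : ∀ i, Integrable (w i) m := fun i => memLp_one_iff_integrable.1 (hwp i 1)
  have hw1 : ∀ i u, ‖w i u‖ ≤ 1 := fun i u => by
    by_cases hu : u ∈ A i <;> simp [hw_def, hu]
  set c : ι → Fin n → G → 𝕜 := fun j i =>
    convolution (k j) (w i) (ContinuousLinearMap.mul 𝕜 𝕜) m
  set Φ : G → ℝ≥0∞ := fun v => ∫⁻ x, ‖fun j : J => ∑ i, c j i v * s x i‖ₑ ^ p.toReal ∂μ
  have hΦm : Measurable Φ := measurable_lintegral_simpleFunc μ s
    (measurable_enorm_convolution_rpow hk J hw hwi hw1)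
  have hΦtot : ∫⁻ v, Φ v ∂m ≤ N ^ p.toReal * (m W * ENNReal.ofReal B ^ p.toReal) := by
    refine (lintegral_convolution_simpleFunc_le hp hk hN J hw hwi (fun i => hwp i p) hw1 s).trans ?_
    gcongr
    calc ∫⁻ v, ∫⁻ x, ‖∑ i, w i v * s x i‖ₑ ^ p.toReal ∂μ ∂m
        ≤ ∫⁻ v, W.indicator (fun _ => ENNReal.ofReal B ^ p.toReal) v ∂m := by
          refine lintegral_mono fun v => ?_
          rw [← Lp.enorm_rpow_toReal hp _ (Lp.coeFn_sum_smul hse fun i => w i v)]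
          by_cases hv : v ∈ W
          · rw [Set.indicator_of_mem hv, ← ofReal_norm]
            gcongr
            exact hH v hv
          · have h0 : ∑ i, w i v • e i = 0 := Finset.sum_eq_zero fun i _ => by
              rw [hw_def]
              simp only
              rw [Set.indicator_of_notMem (fun h => hv (hAW i h)), zero_smul]
            rw [h0, enorm_zero, ENNReal.zero_rpow_of_pos hq]
            exact zero_le
      _ = m W * ENNReal.ofReal B ^ p.toReal := by
          rw [lintegral_indicator_const hW.measurableSet, mul_comm]
  obtain ⟨v, hv, hΦv⟩ := exists_le_setLAverage hV0 hV.measure_ne_top hΦm.aemeasurable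
  refine ⟨v, hv, ?_⟩
  have hkey : Φ v ≤ (N * (ENNReal.ofReal (1 + δ) * ENNReal.ofReal B)) ^ p.toReal := by
    refine hΦv.trans ?_
    rw [setLAverage_eq]
    refine ENNReal.div_le_of_le_mul ?_
    refine (setLIntegral_le_lintegral _ _).trans (hΦtot.trans ?_)
    have h1 : ENNReal.ofReal (1 + δ) ≤ ENNReal.ofReal (1 + δ) ^ p.toReal :=
      ENNReal.le_rpow_self_of_one_le (by simpa using hδ) hq1
    calc N ^ p.toReal * (m W * ENNReal.ofReal B ^ p.toReal)
        ≤ N ^ p.toReal * ((ENNReal.ofReal (1 + δ) ^ p.toReal * m V) *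
            ENNReal.ofReal B ^ p.toReal) := by
          gcongr
          exact hVW.trans (by gcongr)
      _ = (N * (ENNReal.ofReal (1 + δ) * ENNReal.ofReal B)) ^ p.toReal * m V := by
          rw [ENNReal.mul_rpow_of_nonneg _ _ hq.le, ENNReal.mul_rpow_of_nonneg _ _ hq.le]
          ring
  have hfin : ‖Lp.tuple fun j : J => ∑ i, c j i v • e i‖ₑ ^ p.toReal = Φ v := by
    refine Lp.enorm_rpow_toReal hp _ ?_
    have h2 : ∀ᵐ x ∂μ, ∀ j : J, (∑ i, c j i v • e i : Lp 𝕜 p μ) x = ∑ i, c j i v * s x i :=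
      ae_all_iff.2 fun j => Lp.coeFn_sum_smul hse _
    filter_upwards [Lp.coeFn_tuple fun j : J => ∑ i, c j i v • e i, h2] with x h3 h4
    rw [h3]
    exact funext h4
  rw [← hfin, ENNReal.rpow_le_rpow_iff hq] at hkey
  have h5 := ENNReal.toReal_mono (by finiteness) hkey
  rwa [toReal_enorm, ENNReal.toReal_mul, ENNReal.toReal_mul, ENNReal.toReal_ofReal (by positivity),
    ENNReal.toReal_ofReal hB] at h5

omit [m.IsAddHaarMeasure] in
theorem integrable_smul_orbit (hR : IsStronglyContinuousRep R) (hbdd : supOpNorm R < ∞)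
    {k : G → 𝕜} (hk : Integrable k m) (f : Lp 𝕜 p μ) (v : G) :
    Integrable (fun u => k u • R (v - u) f) m :=
  integrable_smul_of_continuous_bounded hk ((hR.continuous_orbit f).comp (continuous_sub_left v))
    fun u => norm_apply_le_toReal_supOpNorm hbdd f (v - u)

omit [m.IsAddHaarMeasure] in
/-- `T_k f = R_{-v} ((k * F)(v))` for the orbit function `F(v) = R_v f`. -/
theorem transferOp_eq (hR : IsStronglyContinuousRep R) (hbdd : supOpNorm R < ∞)
    {k : G → 𝕜} (hk : Integrable k m) (f : Lp 𝕜 p μ) (v : G) :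
    transferOp m R k f = R (-v) (∫ u, k u • R (v - u) f ∂m) := by
  rw [transferOp, ← ContinuousLinearMap.integral_comp_comm _
    (integrable_smul_orbit hR hbdd hk f v)]
  refine integral_congr_ae (Filter.Eventually.of_forall fun u => ?_)
  simp only [map_smul]
  rw [← ContinuousLinearMap.comp_apply, ← hR.map_add]
  congr 3
  abel

/-- The transferred inequality for finitely many kernels, with an error `t`. On the compact set `W`
provided by the Følner condition the orbit function is replaced by a step function `H` that
vanishes off `W`; at the points `v ∈ V` this changes `(k_j * F)(v)` only slightly, because `k_j` is
concentrated on a compact set `K` with `V - K ⊆ W`. -/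
theorem norm_tuple_transferOp_le_add (hp : p ≠ ∞) (hR : IsStronglyContinuousRep R)
    (hbdd : supOpNorm R < ∞) (hsep : ∀ u, IsSeparationPreserving (R u))
    (hk : ∀ j, Integrable (k j) m) (hN : maximalConvolutionNorm p m k < ∞) (J : Finset ι)
    (f : Lp 𝕜 p μ) {t : ℝ} (ht : 0 < t) :
    ‖Lp.tuple fun j : J => transferOp m R (k j) f‖ ≤ (supOpNorm R).toReal *
      ((maximalConvolutionNorm p m k).toReal *
          ((1 + t) * ((supOpNorm R).toReal * ‖f‖ + t)) +
        ∑ j : J, ((∫ u, ‖k j u‖ ∂m) * t + t * ((supOpNorm R).toReal * ‖f‖ + t))) := by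
  set c := (supOpNorm R).toReal
  set M := c * ‖f‖
  have hc0 : 0 ≤ c := ENNReal.toReal_nonneg
  have hM0 : 0 ≤ M := by positivity
  choose g hg hgc hgs hgi using fun j : ι =>
    exists_hasCompactSupport_integral_norm_sub_le (hk j) ht
  have hK : IsCompact (⋃ j ∈ J, tsupport (g j)) := J.isCompact_biUnion fun j _ => hgs j
  obtain ⟨V, W, hV, hW, hVKW, hV0, hVW⟩ := exists_folner m hK ht
  obtain ⟨n, s, e, A, hse, hA, hAW, hFH⟩ := exists_step_approx hp hW (hR.continuous_orbit f) ht
  set H : G → Lp 𝕜 p μ := fun v => ∑ i, (A i).indicator (1 : G → 𝕜) v • e i with hH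
  have hF : ∀ v, ‖R v f‖ ≤ M := norm_apply_le_toReal_supOpNorm hbdd f
  have hHM : ∀ v ∈ W, ‖H v‖ ≤ M + t := fun v hv => by
    have h1 := norm_le_norm_add_norm_sub (R v f) (H v)
    linarith [hF v, hFH v hv]
  obtain ⟨v, hv, hvle⟩ := exists_norm_convolution_le hp hk hN J hse hA hV hW hAW ht.le hV0 hVW
    (by positivity : 0 ≤ M + t) hHM
  set Y : J → Lp 𝕜 p μ := fun j => ∫ u, k j u • R (v - u) f ∂m with hY
  set Z : J → Lp 𝕜 p μ := fun j => ∑ i, convolution (k j) ((A i).indicator (1 : G → 𝕜))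
      (ContinuousLinearMap.mul 𝕜 𝕜) m v • e i with hZ
  have hwm : ∀ i, Measurable ((A i).indicator (1 : G → 𝕜)) := fun i =>
    measurable_one.indicator (hA i)
  have hw1 : ∀ i u, ‖(A i).indicator (1 : G → 𝕜) u‖ ≤ 1 := fun i u => by
    by_cases hu : u ∈ A i <;> simp [hu]
  have hint : ∀ (j : ι) i,
      Integrable (fun u => (k j u * (A i).indicator (1 : G → 𝕜) (v - u)) • e i) m :=
    fun j i => (integrable_mul_comp_sub (hk j) (hwm i) (hw1 i) v).smul_const (e i)
  have hsmulH : ∀ (j : ι) u, k j u • H (v - u) =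
      ∑ i, (k j u * (A i).indicator (1 : G → 𝕜) (v - u)) • e i := fun j u => by
    simp only [hH, Finset.smul_sum, smul_smul]
  have hHint : ∀ j : ι, Integrable (fun u => k j u • H (v - u)) m := fun j => by
    simp only [hsmulH]
    exact integrable_finsetSum _ fun i _ => hint j i
  have hZeq : ∀ j : J, Z j = ∫ u, k j u • H (v - u) ∂m := fun j => by
    simp only [hsmulH]
    rw [integral_finsetSum _ fun i _ => hint j i]
    simp only [hZ, convolution, ContinuousLinearMap.mul_apply', integral_smul_const]
  have hYZ : ∀ j : J, ‖Y j - Z j‖ ≤ (∫ u, ‖k j u‖ ∂m) * t + t * (M + t) := fun j => by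
    rw [hZeq, hY, ← integral_sub (integrable_smul_orbit hR hbdd (hk j) f v) (hHint j)]
    refine (norm_integral_le_of_norm_le
      (((hk j).norm.mul_const t).add (((hk j).sub (hgi j)).norm.mul_const (M + t)))
      (Filter.Eventually.of_forall fun u => ?_)).trans ?_
    · rw [← smul_sub, norm_smul]
      simp only [Pi.add_apply, Pi.sub_apply]
      by_cases hu : u ∈ tsupport (g j)
      · -- here `v - u` lies in `W`, where `H` is close to the orbit function
        have h1 := hFH (v - u) (hVKW v hv u (Set.mem_iUnion₂.2 ⟨j, j.2, hu⟩))
        exact le_add_of_le_of_nonneg (mul_le_mul_of_nonneg_left h1 (norm_nonneg _))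
          (by positivity)
      · -- off the support of `g j` the kernel is equal to `k j - g j`
        have h1 : ‖R (v - u) f - H (v - u)‖ ≤ M + t := by
          by_cases hvu : v - u ∈ W
          · exact (hFH _ hvu).trans (by linarith)
          · have h0 : H (v - u) = 0 := Finset.sum_eq_zero fun i _ => by
              rw [Set.indicator_of_notMem (fun h => hvu (hAW i h)), zero_smul]
            rw [h0, sub_zero]
            linarith [hF (v - u)]
        rw [image_eq_zero_of_notMem_tsupport hu, sub_zero]
        exact le_add_of_nonneg_of_le (by positivity)
          (mul_le_mul_of_nonneg_left h1 (norm_nonneg _))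
    · rw [integral_add' ((hk j).norm.mul_const t) (((hk j).sub (hgi j)).norm.mul_const (M + t)),
        integral_mul_const, integral_mul_const]
      simp only [Pi.sub_apply]
      gcongr
      exact hg j
  have hT : (fun j : J => transferOp m R (k j) f) = fun j => R (-v) (Y j) :=
    funext fun j => transferOp_eq hR hbdd (hk j) f v
  rw [hT]
  refine ((hsep (-v)).norm_tuple_le hp Y).trans ?_
  refine mul_le_mul (norm_le_toReal_supOpNorm hbdd _) ?_ (norm_nonneg _) hc0
  have h2 : Lp.tuple Y = Lp.tuple Z + Lp.tuple (Y - Z) := by rw [Lp.tuple_sub]; abel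
  rw [h2]
  refine (norm_add_le _ _).trans (add_le_add hvle ?_)
  exact (Lp.norm_tuple_le _).trans (Finset.sum_le_sum fun j _ => hYZ j)

theorem norm_tuple_transferOp_le (hp : p ≠ ∞) (hR : IsStronglyContinuousRep R)
    (hbdd : supOpNorm R < ∞) (hsep : ∀ u, IsSeparationPreserving (R u))
    (hk : ∀ j, Integrable (k j) m) (hN : maximalConvolutionNorm p m k < ∞) (J : Finset ι)
    (f : Lp 𝕜 p μ) :
    ‖Lp.tuple fun j : J => transferOp m R (k j) f‖ ≤
      (supOpNorm R).toReal ^ 2 * (maximalConvolutionNorm p m k).toReal * ‖f‖ := by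
  set c := (supOpNorm R).toReal
  set N := (maximalConvolutionNorm p m k).toReal
  have hcont : Continuous fun t : ℝ => c * (N * ((1 + t) * (c * ‖f‖ + t)) +
      ∑ j : J, ((∫ u, ‖k j u‖ ∂m) * t + t * (c * ‖f‖ + t))) := by fun_prop
  have hlim := (hcont.tendsto 0).mono_left (nhdsWithin_le_nhds (s := Set.Ioi 0))
  refine (ge_of_tendsto hlim ?_).trans (le_of_eq ?_)
  · filter_upwards [self_mem_nhdsWithin] with t ht
    exact norm_tuple_transferOp_le_add hp hR hbdd hsep hk hN J f ht
  · simp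
    ring

end Transference

theorem theorem2p7 {G Ω 𝕜 ι : Type*} [RCLike 𝕜]
    [AddCommGroup G] [TopologicalSpace G] [IsTopologicalAddGroup G]
    [LocallyCompactSpace G] [T2Space G] [MeasurableSpace G] [BorelSpace G]
    (m : Measure G) [m.IsAddHaarMeasure] [m.Regular]
    [MeasurableSpace Ω] (μ : Measure Ω)
    (p : ℝ≥0∞) [Fact (1 ≤ p)] (hp : p ≠ ∞)
    (R : G → Lp 𝕜 p μ →L[𝕜] Lp 𝕜 p μ) (hR : IsStronglyContinuousRep R)
    (hbdd : supOpNorm R < ∞) (hsep : ∀ u, IsSeparationPreserving (R u))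
    [Countable ι] (k : ι → G → 𝕜) (hk : ∀ j, Integrable (k j) m)
    (hN : maximalConvolutionNorm p m k < ∞) :
    (∀ (j : ι) (f : Lp 𝕜 p μ), Integrable (fun u => k j u • R (-u) f) m) ∧
    ∀ f : Lp 𝕜 p μ,
      MemLp (transferMaximal m R k f) p μ ∧
      eLpNorm (transferMaximal m R k f) p μ ≤
        supOpNorm R ^ 2 * maximalConvolutionNorm p m k * eLpNorm f p μ := by
  have hp0 : p ≠ 0 := (zero_lt_one.trans_le Fact.out).ne'
  have hq : 0 < p.toReal := ENNReal.toReal_pos hp0 hp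
  refine ⟨fun j f => by simpa using integrable_smul_orbit hR hbdd (hk j) f 0, fun f => ?_⟩
  set C := supOpNorm R ^ 2 * maximalConvolutionNorm p m k * eLpNorm f p μ
  have hCtop : C < ∞ := ENNReal.mul_lt_top (ENNReal.mul_lt_top (ENNReal.pow_lt_top hbdd) hN)
    (Lp.eLpNorm_lt_top f)
  have hmeasj : ∀ j, AEMeasurable (fun x => ‖transferOp m R (k j) f x‖ₑ) μ := fun j =>
    (Lp.aestronglyMeasurable _).enorm
  have hmeas : AEMeasurable (transferMaximal m R k f) μ := AEMeasurable.iSup hmeasj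
  suffices h : eLpNorm (transferMaximal m R k f) p μ ≤ C from
    ⟨⟨hmeas.aestronglyMeasurable, h.trans_lt hCtop⟩, h⟩
  -- the supremum over `ι` is the monotone limit of the suprema over finite subsets
  have hfinite : ∀ J : Finset ι,
      ∫⁻ x, (⨆ j ∈ J, ‖transferOp m R (k j) f x‖ₑ) ^ p.toReal ∂μ ≤ C ^ p.toReal := by
    intro J
    have h1 : ∫⁻ x, (⨆ j ∈ J, ‖transferOp m R (k j) f x‖ₑ) ^ p.toReal ∂μ ≤
        ‖Lp.tuple fun j : J => transferOp m R (k j) f‖ₑ ^ p.toReal := by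
      rw [Lp.enorm_rpow_toReal hp _ (Lp.coeFn_tuple _)]
      gcongr with x
      refine iSup₂_le fun j hj => ?_
      exact enorm_le_iff_norm_le.2 (norm_le_pi_norm
        (fun j : J => transferOp m R (k j) f x) ⟨j, hj⟩)
    refine h1.trans ?_
    gcongr
    have h2 := ENNReal.ofReal_le_ofReal (norm_tuple_transferOp_le hp hR hbdd hsep hk hN J f)
    rwa [ofReal_norm, ENNReal.ofReal_mul (by positivity), ENNReal.ofReal_mul (by positivity),
      ENNReal.ofReal_pow (by positivity), ENNReal.ofReal_toReal hbdd.ne,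
      ENNReal.ofReal_toReal hN.ne, ofReal_norm, Lp.enorm_def f] at h2
  have hsup : ∀ x, ‖transferMaximal m R k f x‖ₑ ^ p.toReal =
      ⨆ J : Finset ι, (⨆ j ∈ J, ‖transferOp m R (k j) f x‖ₑ) ^ p.toReal := by
    intro x
    rw [enorm_eq_self, transferMaximal, iSup_eq_iSup_finset]
    exact (ENNReal.orderIsoRpow p.toReal hq).map_iSup _
  rw [eLpNorm_eq_lintegral_rpow_enorm_toReal hp0 hp, one_div, ENNReal.rpow_inv_le_iff hq]
  simp only [hsup]
  rw [lintegral_iSup_directed]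
  · exact iSup_le hfinite
  · exact fun J => (AEMeasurable.biSup _ J.countable_toSet fun j _ => hmeasj j).pow_const _
  · refine Monotone.directed_le fun J J' hJ x => ?_
    exact ENNReal.rpow_le_rpow (biSup_mono fun j hj => hJ hj) hq.le
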